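/- Theorem. Let $n\ge 2$. For $\delta\in(0,n]$ and $E\subset\mathbb{R}^n$ let $$\mathcal H^{\delta}_\infty(E)=\inf\Big\{\sum_{i=1}^\infty r_i^{\delta} : E\subset\bigcup_{i=1}^\infty B(x_i,r_i),\ r_i>0\Big\},$$ the infimum being taken over countable (or finite) coverings of $E$ by open balls. For $\Omega\subset\mathbb{R}^n$ open and $f:\Omega\to[0,\infty]$ let $$\int_\Omega f\,d\mathcal H^{\delta}_\infty=\int_0^\infty \mathcal H^{\delta}_\infty(\{x\in\Omega: f(x)>t\})\,dt .$$ A bounded domain (nonempty, open, connected, bounded set) $\Omega\subset\mathbb{R}^n$ is an $(\alpha,\beta)$-John domain, where $0<\alpha\le\beta<\infty$, if there is a point $x_0\in\Omega$ such that every $x\in\Omega$ can be joined to $x_0$ by a rectifiable curve $\gamma_x:[0,\ell(\gamma_x)]\to\Omega$, parametrised by arc length, with $\gamma_x(0)=x$, $\gamma_x(\ell(\gamma_x))=x_0$, $\ell(\gamma_x)\le\beta$ and $\operatorname{dist}(\gamma_x(t),\partial\Omega)\ge\frac{\alpha}{\beta}t$ for all $t\in[0,\ell(\gamma_x)]$.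 Let $\Omega$ be a bounded $(\alpha,\beta)$-John domain in $\mathbb{R}^n$, let $\delta\in(0,n]$ and let $\varepsilon\in(0,\delta(1-\frac1n))$. Then there is a constant $0<c<\infty$, depending only on $\alpha,\beta,\delta,\varepsilon,n$ and $\mathcal H^{\delta}_\infty(\Omega)$, such that for all $u\in C^1(\Omega)$ $$\inf_{b\in\mathbb{R}}\Big(\int_\Omega|u(x)-b|^{\frac{\delta}{n-1}}\,d\mathcal H^{\delta}_\infty\Big)^{\frac{n-1}{\delta}}\le c\Big(\int_\Omega|\nabla u(x)|^{\frac{\delta}{n}}\,d\mathcal H^{\delta-\varepsilon}_\infty\Big)^{\frac{n}{\delta}} ,$$ where both sides take values in $[0,\infty]$ and $c\cdot\infty=\infty$. -/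

import Mathlib

open MeasureTheory
open scoped ENNReal Gradient

noncomputable section

/-- The `δ`-dimensional Hausdorff content of a set `A ⊆ ℝⁿ`: the infimum of `∑ rᵢ ^ δ` over all
coverings of `A` by sequences of open balls of positive radii `rᵢ`. (For `δ > 0`, finite coverings
give the same infimum, since they can be padded with balls of arbitrarily small total cost.) -/
def hausdorffContent {n : ℕ} (δ : ℝ) (A : Set (EuclideanSpace ℝ (Fin n))) : ℝ≥0∞ :=
  ⨅ (x : ℕ → EuclideanSpace ℝ (Fin n)) (r : ℕ → ℝ) (_ : ∀ i, 0 < r i)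
    (_ : A ⊆ ⋃ i, Metric.ball (x i) (r i)), ∑' i, ENNReal.ofReal (r i ^ δ)

/-- The Choquet integral over `Ω` of a function with values in `[0, ∞]` with respect to the
`δ`-dimensional Hausdorff content. Only the values of `f` on `Ω` matter. -/
def choquetIntegral {n : ℕ} (δ : ℝ) (Ω : Set (EuclideanSpace ℝ (Fin n)))
    (f : EuclideanSpace ℝ (Fin n) → ℝ≥0∞) : ℝ≥0∞ :=
  ∫⁻ t in Set.Ioi (0 : ℝ), hausdorffContent δ {x | x ∈ Ω ∧ ENNReal.ofReal t < f x}

/-- Bounded `(α, β)`-John domains in `ℝⁿ`. `HasUnitSpeedOn γ (Set.Icc 0 ℓ)` says that `γ` is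
parametrised by arc length on `[0, ℓ]`; in particular it is rectifiable (and continuous) there,
and its length is `ℓ`. -/
structure IsBoundedJohnDomain {n : ℕ} (α β : ℝ) (Ω : Set (EuclideanSpace ℝ (Fin n))) : Prop where
  isOpen : IsOpen Ω
  isConnected : IsConnected Ω
  isBounded : Bornology.IsBounded Ω
  pos : 0 < α
  le : α ≤ β
  exists_center : ∃ x₀ ∈ Ω, ∀ x ∈ Ω, ∃ (ℓ : ℝ) (γ : ℝ → EuclideanSpace ℝ (Fin n)),
    0 ≤ ℓ ∧ ℓ ≤ β ∧ HasUnitSpeedOn γ (Set.Icc 0 ℓ) ∧ Set.MapsTo γ (Set.Icc 0 ℓ) Ω ∧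
      γ 0 = x ∧ γ ℓ = x₀ ∧
      ∀ t ∈ Set.Icc 0 ℓ, α / β * t ≤ Metric.infDist (γ t) (frontier Ω)

end

/-! The loss `ε` in the dimension on the right makes a weak type estimate of exponent larger than
`δ/(n-1)` available; since the content of `Ω` is finite, that estimate integrates to the strong one.
Write `p = δ/n`.

Let `b` be the mean of `u` over a fixed ball around the John centre. Follow the John curve from `x`,
averaging `u` over balls of radius `τ t` around `γ t`. If the gradient integrals over all these
balls were at most `c s (τ t)^(n-1+η)`, the averages would move at rate O(`s t^(η-1)`), which is
integrable at `0`, so that `|u x - b| ≤ s`. Hence `|u x - b| > s` forces a ball in `Ω`, of radius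
comparable to its reach from `x`, with large gradient integral
(`exists_lt_integral_fderiv_of_isBoundedJohnDomain`).

Cover the sets where `|∇u|^p > 2^k` almost optimally for the content of dimension `δ - ε`, and put
mass `2^(k+1) l^(δ-ε)` at the centre of each covering ball of radius `l`. The total mass is
controlled by the right-hand Choquet integral (`exists_cover_superlevel`). A large gradient integral
near `x` gives this measure mass at least of order `s^p r^D` on a ball of radius comparable to `r`
around `x`, where `D = δ - ε - p(1-η)` (`exists_density_of_lt_lintegral`). Vitali's lemma turns this
into a bound for the content of `{|u - b| > s}` (`hausdorffContent_le_of_density`) with decay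
exponent `σ = pδ/D`. Taking `pη < ε` gives `D < p(n-1)`, that is `σ > δ/(n-1)`, and
`choquetIntegral_rpow_le_of_weakType` concludes. -/

/-! ### Hausdorff content and Choquet integrals. -/

theorem hausdorffContent_le_tsum {n : ℕ} {δ : ℝ} (hδ : 0 < δ) {ι : Type*} [Countable ι]
    {A : Set (EuclideanSpace ℝ (Fin n))} (x : ι → EuclideanSpace ℝ (Fin n)) (r : ι → ℝ)
    (hr : ∀ i, 0 < r i) (hA : A ⊆ ⋃ i, Metric.ball (x i) (r i)) :
    hausdorffContent δ A ≤ ∑' i, ENNReal.ofReal (r i ^ δ) := by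
  refine ENNReal.le_of_forall_pos_le_add fun e he _ => ?_
  obtain ⟨e', he', hsum⟩ := ENNReal.exists_pos_sum_of_countable
    (ε := (e : ℝ≥0∞)) (by simpa using he.ne') ℕ
  obtain ⟨_⟩ := nonempty_encodable ι
  have : Encodable (ι ⊕ ℕ) := inferInstance
  have : Denumerable (ι ⊕ ℕ) := Denumerable.ofEncodableOfInfinite _
  let f : ℕ ≃ ι ⊕ ℕ := (Denumerable.eqv (ι ⊕ ℕ)).symm
  let X : ι ⊕ ℕ → EuclideanSpace ℝ (Fin n) := Sum.elim x fun _ => 0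
  -- The given family may be finite, so it is padded with balls whose costs are exactly `e' i`.
  let R : ι ⊕ ℕ → ℝ := Sum.elim r fun i => (e' i : ℝ) ^ (1 / δ)
  have hR : ∀ j, 0 < R j := by
    rintro (i | i)
    · exact hr i
    · exact Real.rpow_pos_of_pos (he' i) _
  have hcov : A ⊆ ⋃ i, Metric.ball (X (f i)) (R (f i)) := by
    intro y hy
    obtain ⟨i, hi⟩ := Set.mem_iUnion.1 (hA hy)
    refine Set.mem_iUnion.2 ⟨f.symm (.inl i), ?_⟩
    simpa [X, R] using hi
  calc hausdorffContent δ A ≤ ∑' i, ENNReal.ofReal (R (f i) ^ δ) :=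
        iInf_le_of_le _ <| iInf_le_of_le _ <| iInf_le_of_le (fun i => hR (f i)) <|
          iInf_le_of_le hcov le_rfl
    _ = ∑' j, ENNReal.ofReal (R j ^ δ) := f.tsum_eq fun j => ENNReal.ofReal (R j ^ δ)
    _ = ∑' i, ENNReal.ofReal (r i ^ δ) + ∑' i, (e' i : ℝ≥0∞) := by
        rw [ENNReal.summable.tsum_sum ENNReal.summable]
        congr 1
        refine tsum_congr fun i => ?_
        simp only [R, Sum.elim_inr]
        rw [← Real.rpow_mul (NNReal.coe_nonneg _), one_div_mul_cancel hδ.ne', Real.rpow_one,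
          ENNReal.ofReal_coe_nnreal]
    _ ≤ _ := by gcongr

theorem hausdorffContent_mono {n : ℕ} {δ : ℝ} {A B : Set (EuclideanSpace ℝ (Fin n))}
    (h : A ⊆ B) : hausdorffContent δ A ≤ hausdorffContent δ B :=
  le_iInf fun x => le_iInf fun r => le_iInf fun hr => le_iInf fun hB =>
    iInf_le_of_le x <| iInf_le_of_le r <| iInf_le_of_le hr <| iInf_le_of_le (h.trans hB) le_rfl

theorem hausdorffContent_ball_le {n : ℕ} {δ : ℝ} (hδ : 0 < δ) (x : EuclideanSpace ℝ (Fin n))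
    {r : ℝ} (hr : 0 < r) : hausdorffContent δ (Metric.ball x r) ≤ ENNReal.ofReal (r ^ δ) := by
  have := hausdorffContent_le_tsum hδ (ι := Unit) (A := Metric.ball x r) (fun _ => x)
    (fun _ => r) (fun _ => hr) (by simp [Set.iUnion_const])
  simpa using this

/-- A nearly optimal covering in the definition of the Hausdorff content. -/
theorem exists_cover_of_hausdorffContent_lt {n : ℕ} {δ : ℝ} {A : Set (EuclideanSpace ℝ (Fin n))}
    {a : ℝ≥0∞} (h : hausdorffContent δ A < a) :
    ∃ (x : ℕ → EuclideanSpace ℝ (Fin n)) (r : ℕ → ℝ), (∀ i, 0 < r i) ∧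
      (A ⊆ ⋃ i, Metric.ball (x i) (r i)) ∧ ∑' i, ENNReal.ofReal (r i ^ δ) < a := by
  simp only [hausdorffContent, iInf_lt_iff] at h
  obtain ⟨x, r, hr, hA, h⟩ := h
  exact ⟨x, r, hr, hA, h⟩

/-- The Choquet integral dominates its dyadic lower sums. -/
theorem tsum_zpow_mul_hausdorffContent_le {n : ℕ} (δ : ℝ) (Ω : Set (EuclideanSpace ℝ (Fin n)))
    (f : EuclideanSpace ℝ (Fin n) → ℝ≥0∞) :
    ∑' k : ℤ, ENNReal.ofReal (2 ^ k) *
        hausdorffContent δ {x | x ∈ Ω ∧ ENNReal.ofReal (2 ^ k) < f x} ≤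
      2 * choquetIntegral δ Ω f := by
  set H : ℝ → ℝ≥0∞ := fun t => hausdorffContent δ {x | x ∈ Ω ∧ ENNReal.ofReal t < f x} with hH
  have hanti : Antitone H := fun s t hst => hausdorffContent_mono fun x hx =>
    ⟨hx.1, (ENNReal.ofReal_le_ofReal hst).trans_lt hx.2⟩
  -- Each interval has length `2^k / 2`, and `H` is at least `H (2^k)` on it; this is the factor 2.
  let I : ℤ → Set ℝ := fun k => Set.Ioc ((2 : ℝ) ^ (k - 1)) (2 ^ k)
  have hdisj : Pairwise (Function.onFun Disjoint I) := by
    have := (zpow_right_mono₀ (one_le_two (α := ℝ))).pairwise_disjoint_on_Ioc_pred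
    exact this
  have hI : ∀ k, ENNReal.ofReal (2 ^ k) * H (2 ^ k) ≤ 2 * ∫⁻ t in I k, H t := by
    intro k
    have h1 : ∫⁻ _ in I k, H (2 ^ k) ≤ ∫⁻ t in I k, H t :=
      setLIntegral_mono' measurableSet_Ioc fun t ht => hanti ht.2
    have h2 : (2 : ℝ) ^ k = 2 * (2 ^ k - 2 ^ (k - 1)) := by
      rw [zpow_sub_one₀ two_ne_zero]; ring
    rw [setLIntegral_const, Real.volume_Ioc] at h1
    calc _ = 2 * (H (2 ^ k) * ENNReal.ofReal (2 ^ k - 2 ^ (k - 1))) := by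
          conv_lhs => rw [h2, ENNReal.ofReal_mul zero_le_two]
          rw [← h2]
          simp; ring
      _ ≤ _ := by gcongr
  calc _ ≤ ∑' k, 2 * ∫⁻ t in I k, H t := ENNReal.tsum_le_tsum hI
    _ = 2 * ∫⁻ t in ⋃ k, I k, H t := by
      rw [ENNReal.tsum_mul_left, lintegral_iUnion (fun _ => measurableSet_Ioc) hdisj]
    _ ≤ _ := by
      gcongr
      refine lintegral_mono_set (Set.iUnion_subset fun k t ht => ?_)
      exact (zpow_pos two_pos _).trans ht.1

/-- A weak type bound integrates to a strong one of smaller exponent, for a content that is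
bounded. -/
theorem choquetIntegral_rpow_le_of_weakType {n : ℕ} {δ q σ M C L : ℝ} (hq : 0 < q) (hqσ : q < σ)
    (hM : 0 ≤ M) (hC : 0 ≤ C) (hL : 0 < L) {Ω : Set (EuclideanSpace ℝ (Fin n))}
    (hΩ : hausdorffContent δ Ω ≤ ENNReal.ofReal M) (v : EuclideanSpace ℝ (Fin n) → ℝ)
    (hv : ∀ s, 0 < s → hausdorffContent δ {x | x ∈ Ω ∧ s < |v x|} ≤
      ENNReal.ofReal (C * (L / s) ^ σ)) :
    (choquetIntegral δ Ω fun x => ENNReal.ofReal (|v x| ^ q)) ^ (1 / q) ≤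
      ENNReal.ofReal ((M + C / (σ / q - 1)) ^ (1 / q)) * ENNReal.ofReal L := by
  have hσq : 1 < σ / q := (one_lt_div hq).2 hqσ
  have key : choquetIntegral δ Ω (fun x => ENNReal.ofReal (|v x| ^ q)) ≤
      ENNReal.ofReal ((M + C / (σ / q - 1)) * L ^ q) := by
    have hLq : 0 < L ^ q := Real.rpow_pos_of_pos hL q
    have hset : ∀ t : ℝ, 0 < t → {x | x ∈ Ω ∧ ENNReal.ofReal t < ENNReal.ofReal (|v x| ^ q)} ⊆
        {x | x ∈ Ω ∧ t ^ (1 / q) < |v x|} := by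
      rintro t ht x ⟨hx, h⟩
      refine ⟨hx, ?_⟩
      rw [ENNReal.ofReal_lt_ofReal_iff_of_nonneg ht.le] at h
      have := Real.rpow_lt_rpow ht.le h (one_div_pos.2 hq)
      rwa [← Real.rpow_mul (abs_nonneg _), mul_one_div_cancel hq.ne', Real.rpow_one] at this
    -- Below `L ^ q` only the content of `Ω` is used; above it the weak bound decays like
    -- `t^(-σ/q)`, which is integrable because `q < σ`.
    rw [choquetIntegral, ← Set.Ioc_union_Ioi_eq_Ioi hLq.le]
    refine (lintegral_union_le _ _ _).trans ?_
    rw [add_mul, ENNReal.ofReal_add (by positivity) (by have : 0 < σ / q - 1 := by linarith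
                                                        positivity)]
    gcongr
    · calc _ ≤ ∫⁻ _ in Set.Ioc 0 (L ^ q), ENNReal.ofReal M :=
            setLIntegral_mono' measurableSet_Ioc fun t _ =>
              (hausdorffContent_mono fun x hx => hx.1).trans hΩ
        _ = _ := by
            rw [setLIntegral_const, Real.volume_Ioc, sub_zero, ENNReal.ofReal_mul hM]
    · have hint := integrableOn_Ioi_rpow_of_lt (a := -(σ / q)) (by linarith) hLq
      calc _ ≤ ∫⁻ t in Set.Ioi (L ^ q), ENNReal.ofReal (C * L ^ σ * t ^ (-(σ / q))) := by
            refine setLIntegral_mono' measurableSet_Ioi fun t ht => ?_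
            have ht0 : 0 < t := hLq.trans ht
            refine (hausdorffContent_mono (hset t ht0)).trans
              ((hv _ (Real.rpow_pos_of_pos ht0 _)).trans (le_of_eq ?_))
            rw [Real.div_rpow hL.le (by positivity), ← Real.rpow_mul ht0.le,
              Real.rpow_neg ht0.le, one_div_mul_eq_div]
            ring_nf
        _ = ENNReal.ofReal (∫ t in Set.Ioi (L ^ q), C * L ^ σ * t ^ (-(σ / q))) := by
            rw [ofReal_integral_eq_lintegral_ofReal (hint.const_mul _)]
            filter_upwards [self_mem_ae_restrict measurableSet_Ioi] with t ht
            have : 0 < t := hLq.trans ht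
            positivity
        _ ≤ _ := by
            refine ENNReal.ofReal_le_ofReal (le_of_eq ?_)
            rw [integral_const_mul, integral_Ioi_rpow_of_lt (by linarith) hLq,
              ← Real.rpow_mul hL.le]
            have h1 : L ^ σ * L ^ (q * (-(σ / q) + 1)) = L ^ q := by
              rw [← Real.rpow_add hL]; congr 1; field_simp; ring
            have h2 : -(σ / q) + 1 = -(σ / q - 1) := by ring
            rw [← h1, h2, div_neg, neg_div, neg_neg]
            ring
  calc _ ≤ (ENNReal.ofReal ((M + C / (σ / q - 1)) * L ^ q)) ^ (1 / q) := by gcongr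
    _ = _ := by
      have h0 : 0 ≤ M + C / (σ / q - 1) := by
        have : 0 < σ / q - 1 := by linarith
        positivity
      rw [ENNReal.ofReal_rpow_of_nonneg (by positivity) (by positivity),
        Real.mul_rpow h0 (by positivity), ← Real.rpow_mul hL.le, mul_one_div_cancel hq.ne',
        Real.rpow_one, ENNReal.ofReal_mul (by positivity)]

/-! ### Averages over balls moving along a curve. -/

/-- The ball is connected and misses the frontier, so it cannot meet both `Ω` and the complement of
its closure. -/
theorem closedBall_subset_of_lt_infDist_frontier {E : Type*} [NormedAddCommGroup E]
    [NormedSpace ℝ E] {Ω : Set E} (hΩ : IsOpen Ω) {y : E} (hy : y ∈ Ω) {ρ : ℝ} (hρ : 0 ≤ ρ)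
    (h : ρ < Metric.infDist y (frontier Ω)) : Metric.closedBall y ρ ⊆ Ω := by
  refine (convex_closedBall y ρ).isPreconnected.subset_left_of_subset_union hΩ
    (isClosed_closure (s := Ω)).isOpen_compl
    (Set.disjoint_compl_right_iff_subset.2 subset_closure) (fun z hz => ?_)
    ⟨y, Metric.mem_closedBall_self hρ, hy⟩
  by_contra hn
  simp only [Set.mem_union, Set.mem_compl_iff, not_or, not_not] at hn
  have hf : z ∈ frontier Ω := by
    rw [hΩ.frontier_eq]; exact ⟨hn.2, hn.1⟩
  have h1 := Metric.infDist_le_dist_of_mem (x := y) hf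
  rw [dist_comm] at h1
  exact absurd (h1.trans hz) (not_le.2 h)

theorem HasUnitSpeedOn.dist_le {E : Type*} [PseudoMetricSpace E] {γ : ℝ → E} {s : Set ℝ}
    (h : HasUnitSpeedOn γ s) {a b : ℝ} (ha : a ∈ s) (hb : b ∈ s) :
    dist (γ a) (γ b) ≤ |a - b| := by
  wlog hab : a ≤ b generalizing a b
  · rw [dist_comm, abs_sub_comm]
    exact this hb ha (le_of_not_ge hab)
  have h1 := eVariationOn.edist_le γ (s := s ∩ Set.Icc a b) ⟨ha, Set.left_mem_Icc.2 hab⟩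
    ⟨hb, Set.right_mem_Icc.2 hab⟩
  rw [h ha hb, edist_dist, ENNReal.ofReal_le_ofReal_iff (by simpa using hab)] at h1
  rw [abs_sub_comm, abs_of_nonneg (sub_nonneg.2 hab)]
  simpa using h1

section Oscillation

variable {n : ℕ}

theorem integral_comp_add_smul_closedBall (f : EuclideanSpace ℝ (Fin n) → ℝ)
    (y : EuclideanSpace ℝ (Fin n)) {ρ : ℝ} (hρ : 0 < ρ) :
    ∫ z in Metric.closedBall (0 : EuclideanSpace ℝ (Fin n)) 1, f (y + ρ • z) =
      (ρ ^ n)⁻¹ * ∫ z in Metric.closedBall y ρ, f z := by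
  have h := Measure.setIntegral_comp_smul_of_pos volume (fun z => f (y + z))
    (Metric.closedBall (0 : EuclideanSpace ℝ (Fin n)) 1) hρ
  have h2 : ∫ z in Metric.closedBall y ρ, f z =
      ∫ z in Metric.closedBall (0 : EuclideanSpace ℝ (Fin n)) ρ, f (y + z) := by
    rw [← (measurePreserving_add_left volume y).setIntegral_preimage_emb
      (measurableEmbedding_addLeft y)]
    simp [preimage_add_closedBall]
  rw [h, h2, _root_.smul_closedBall _ _ zero_le_one]
  simp [abs_of_pos hρ]

/-- Uniform first order control of a `C¹` function near a compact set. -/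
theorem exists_radius_abs_sub_le {Ω : Set (EuclideanSpace ℝ (Fin n))} (hΩ : IsOpen Ω)
    {u : EuclideanSpace ℝ (Fin n) → ℝ} (hu : ContDiffOn ℝ 1 u Ω)
    {K : Set (EuclideanSpace ℝ (Fin n))} (hK : IsCompact K) (hKΩ : K ⊆ Ω) {e : ℝ} (he : 0 < e) :
    ∃ θ > 0, ∀ y ∈ K, ∀ y', dist y y' < θ → |u y' - u y| ≤ (‖fderiv ℝ u y‖ + e) * dist y y' := by
  have hcont : ContinuousOn (fderiv ℝ u) Ω := hu.continuousOn_fderiv_of_isOpen hΩ le_rfl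
  have hunif := hK.uniformContinuousAt_of_continuousAt (fderiv ℝ u)
    (fun a ha => hcont.continuousAt (hΩ.mem_nhds (hKΩ ha))) (Metric.dist_mem_uniformity he)
  obtain ⟨θ₁, hθ₁, h1⟩ := Metric.mem_uniformity_dist.1 hunif
  obtain ⟨θ₂, hθ₂, h2⟩ := hK.exists_thickening_subset_open hΩ hKΩ
  refine ⟨min θ₁ θ₂, lt_min hθ₁ hθ₂, fun y hy y' hyy' => ?_⟩
  have hballΩ : Metric.ball y (min θ₁ θ₂) ⊆ Ω := fun z hz =>
    h2 (Metric.mem_thickening_iff.2 ⟨y, hy, hz.trans_le (min_le_right _ _)⟩)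
  have := (convex_ball y (min θ₁ θ₂)).norm_image_sub_le_of_norm_fderiv_le (𝕜 := ℝ) (f := u)
    (C := ‖fderiv ℝ u y‖ + e)
    (fun z hz => (hu.differentiableOn one_ne_zero).differentiableAt (hΩ.mem_nhds (hballΩ hz)))
    (fun z hz => by
      have hz' : dist y z < θ₁ := by
        rw [dist_comm]; exact (Metric.mem_ball.1 hz).trans_le (min_le_left _ _)
      have h3 : dist (fderiv ℝ u y) (fderiv ℝ u z) < e := h1 hz' hy
      rw [dist_eq_norm, ← norm_neg, neg_sub] at h3
      have := norm_add_le (fderiv ℝ u y) (fderiv ℝ u z - fderiv ℝ u y)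
      rw [add_sub_cancel] at this
      linarith)
    (Metric.mem_ball_self (lt_min hθ₁ hθ₂)) (by rwa [Metric.mem_ball, dist_comm])
  rwa [dist_comm, dist_eq_norm]

variable {Ω : Set (EuclideanSpace ℝ (Fin n))} {u : EuclideanSpace ℝ (Fin n) → ℝ}
  {γ : ℝ → EuclideanSpace ℝ (Fin n)} {T τ : ℝ}

theorem add_smul_mem_closedBall {y z : EuclideanSpace ℝ (Fin n)} {ρ : ℝ} (hρ : 0 ≤ ρ)
    (hz : z ∈ Metric.closedBall (0 : EuclideanSpace ℝ (Fin n)) 1) :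
    y + ρ • z ∈ Metric.closedBall y ρ := by
  rw [mem_closedBall_iff_norm, add_sub_cancel_left, norm_smul, Real.norm_of_nonneg hρ]
  exact mul_le_of_le_one_right hρ (by simpa using hz)

theorem integrableOn_comp_add_smul {f : EuclideanSpace ℝ (Fin n) → ℝ} (hf : ContinuousOn f Ω)
    {y : EuclideanSpace ℝ (Fin n)} {ρ : ℝ} (hρ : 0 ≤ ρ) (hy : Metric.closedBall y ρ ⊆ Ω) :
    IntegrableOn (fun z => f (y + ρ • z)) (Metric.closedBall 0 1) :=
  (hf.comp (by fun_prop) fun _ hz => hy (add_smul_mem_closedBall hρ hz)).integrableOn_compact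
    (isCompact_closedBall _ _)

/-- The average of `u` over balls moving along a Lipschitz curve depends continuously on time. -/
theorem continuousOn_integral_moving_ball (hu : ContinuousOn u Ω) (hτ : 0 ≤ τ)
    (hγ : ContinuousOn γ (Set.Icc 0 T))
    (hball : ∀ t ∈ Set.Icc 0 T, Metric.closedBall (γ t) (τ * t) ⊆ Ω) :
    ContinuousOn (fun t => ∫ z in Metric.closedBall (0 : EuclideanSpace ℝ (Fin n)) 1,
      u (γ t + (τ * t) • z)) (Set.Icc 0 T) := by
  set S : Set (ℝ × EuclideanSpace ℝ (Fin n)) := Set.Icc 0 T ×ˢ Metric.closedBall 0 1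
  have hF : ContinuousOn (fun q : ℝ × EuclideanSpace ℝ (Fin n) => u (γ q.1 + (τ * q.1) • q.2)) S := by
    refine hu.comp (ContinuousOn.add (hγ.comp continuousOn_fst fun q hq => hq.1) (by fun_prop))
      fun q hq => hball _ hq.1 (add_smul_mem_closedBall (mul_nonneg hτ hq.1.1) hq.2)
  obtain ⟨M, hM⟩ := (isCompact_Icc.prod (isCompact_closedBall _ _)).exists_bound_of_continuousOn hF
  refine continuousOn_of_dominated (bound := fun _ => M) (fun t ht => ?_) (fun t ht => ?_) ?_ ?_
  · exact (integrableOn_comp_add_smul hu (mul_nonneg hτ ht.1) (hball t ht)).aestronglyMeasurable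
  · filter_upwards [self_mem_ae_restrict Metric.isClosed_closedBall.measurableSet] with z hz
    exact hM (t, z) ⟨ht, hz⟩
  · exact integrable_const_iff.2 (Or.inr ⟨by
      simpa using (isCompact_closedBall (0 : EuclideanSpace ℝ (Fin n)) 1).measure_lt_top⟩)
  · filter_upwards [self_mem_ae_restrict Metric.isClosed_closedBall.measurableSet] with z hz
    exact hF.comp (f := fun t => (t, z)) (by fun_prop) fun t ht => ⟨ht, hz⟩

/-- For `z` in the unit ball the point `γ t + (τ * t) • z` moves at speed at most `1 + τ`. Since `γ`
is only Lipschitz, the conclusion bounds right difference quotients rather than a derivative. -/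
theorem eventually_abs_sub_integral_moving_ball_le (hΩ : IsOpen Ω) (hu : ContDiffOn ℝ 1 u Ω)
    (hτ : 0 < τ) (hγ : ∀ s ∈ Set.Icc 0 T, ∀ t ∈ Set.Icc 0 T, dist (γ s) (γ t) ≤ |s - t|)
    (hball : ∀ t ∈ Set.Icc 0 T, Metric.closedBall (γ t) (τ * t) ⊆ Ω) {t : ℝ} (ht : 0 < t)
    (htT : t < T) {r : ℝ} (hr : (1 + τ) * ((τ * t) ^ n)⁻¹ *
      ∫ z in Metric.closedBall (γ t) (τ * t), ‖fderiv ℝ u z‖ < r) :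
    ∀ᶠ s in nhdsWithin t (Set.Ioi t),
      |(∫ z in Metric.closedBall (0 : EuclideanSpace ℝ (Fin n)) 1, u (γ s + (τ * s) • z)) -
        ∫ z in Metric.closedBall (0 : EuclideanSpace ℝ (Fin n)) 1, u (γ t + (τ * t) • z)| ≤
      r * (s - t) := by
  set ω := volume.real (Metric.closedBall (0 : EuclideanSpace ℝ (Fin n)) 1) with hω
  have hω0 : 0 ≤ ω := measureReal_nonneg
  have hρ : 0 < τ * t := mul_pos hτ ht
  rw [mul_assoc, ← integral_comp_add_smul_closedBall (fun z => ‖fderiv ℝ u z‖) _ hρ] at hr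
  set J := ∫ z in Metric.closedBall (0 : EuclideanSpace ℝ (Fin n)) 1,
    ‖fderiv ℝ u (γ t + (τ * t) • z)‖ with hJ
  -- The strict inequality in `hr` leaves room for the first order error `e` of `u`, uniform on the
  -- ball.
  obtain ⟨e, he, her⟩ : ∃ e > 0, (1 + τ) * (J + ω * e) ≤ r := by
    refine ⟨(r - (1 + τ) * J) / ((1 + τ) * (ω + 1)),
      div_pos (sub_pos.2 hr) (by positivity), ?_⟩
    have h1 : ω * ((r - (1 + τ) * J) / ((1 + τ) * (ω + 1))) ≤ (r - (1 + τ) * J) / (1 + τ) := by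
      rw [mul_div_assoc', div_le_div_iff₀ (by positivity) (by positivity)]
      have : 0 ≤ (r - (1 + τ) * J) * (1 + τ) := mul_nonneg (sub_pos.2 hr).le (by positivity)
      nlinarith
    calc _ ≤ (1 + τ) * (J + (r - (1 + τ) * J) / (1 + τ)) := by gcongr
      _ = r := by field_simp; ring
  have htm : t ∈ Set.Icc 0 T := ⟨ht.le, htT.le⟩
  obtain ⟨θ, hθ, hest⟩ := exists_radius_abs_sub_le hΩ hu (isCompact_closedBall (γ t) (τ * t))
    (hball t htm) he
  have hev : ∀ᶠ s in nhdsWithin t (Set.Ioi t), s ∈ Set.Ioo t (min T (t + θ / (1 + τ))) :=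
    Ioo_mem_nhdsGT (lt_min htT (lt_add_of_pos_right _ (by positivity)))
  filter_upwards [hev] with s hs
  have hst : 0 < s - t := sub_pos.2 hs.1
  have hsm : s ∈ Set.Icc 0 T := ⟨(ht.trans hs.1).le, (hs.2.trans_le (min_le_left _ _)).le⟩
  have hs2 : (1 + τ) * (s - t) < θ := by
    have := hs.2.trans_le (min_le_right _ _)
    rw [← sub_lt_iff_lt_add', lt_div_iff₀ (by positivity)] at this
    linarith
  have huc := hu.continuousOn
  have hgc : ContinuousOn (fun z => ‖fderiv ℝ u z‖) Ω :=
    (hu.continuousOn_fderiv_of_isOpen hΩ le_rfl).norm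
  have hi1 := integrableOn_comp_add_smul huc (mul_nonneg hτ.le hsm.1) (hball s hsm)
  have hi2 := integrableOn_comp_add_smul huc hρ.le (hball t htm)
  have hi3 := integrableOn_comp_add_smul hgc hρ.le (hball t htm)
  have hconst : IntegrableOn (fun _ : EuclideanSpace ℝ (Fin n) => e) (Metric.closedBall 0 1) :=
    continuousOn_const.integrableOn_compact (isCompact_closedBall _ _)
  rw [← integral_sub hi1 hi2]
  calc _ ≤ ∫ z in Metric.closedBall (0 : EuclideanSpace ℝ (Fin n)) 1,
        |u (γ s + (τ * s) • z) - u (γ t + (τ * t) • z)| := abs_integral_le_integral_abs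
    _ ≤ ∫ z in Metric.closedBall (0 : EuclideanSpace ℝ (Fin n)) 1,
        (‖fderiv ℝ u (γ t + (τ * t) • z)‖ + e) * ((1 + τ) * (s - t)) := by
      refine setIntegral_mono_on (hi1.sub hi2).abs ((hi3.add hconst).mul_const _)
        Metric.isClosed_closedBall.measurableSet fun z hz => ?_
      have hd : dist (γ t + (τ * t) • z) (γ s + (τ * s) • z) ≤ (1 + τ) * (s - t) := by
        calc _ ≤ dist (γ t) (γ s) + dist ((τ * t) • z) ((τ * s) • z) := dist_add_add_le _ _ _ _
          _ ≤ (s - t) + τ * (s - t) := by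
            gcongr
            · have := hγ t htm s hsm
              rwa [abs_sub_comm, abs_of_pos hst] at this
            · rw [dist_comm, dist_eq_norm, ← sub_smul, ← mul_sub, norm_smul,
                Real.norm_of_nonneg (by positivity)]
              exact mul_le_of_le_one_right (by positivity) (by simpa using hz)
          _ = _ := by ring
      refine (hest _ (add_smul_mem_closedBall hρ.le hz) _ (hd.trans_lt hs2)).trans ?_
      gcongr
    _ = (1 + τ) * (J + ω * e) * (s - t) := by
      rw [integral_mul_const, integral_add hi3 hconst, setIntegral_const, smul_eq_mul]
      ring
    _ ≤ _ := by gcongr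

/-- If the mean gradient on the balls of radius `τ t` around `γ t` is small in the sense of a
Morrey type condition, then `u (γ 0)` is close to the average of `u` on the last ball. -/
theorem abs_sub_average_le_of_morrey (hΩ : IsOpen Ω) (hu : ContDiffOn ℝ 1 u Ω)
    (hτ : 0 < τ) (hT : 0 ≤ T)
    (hγ : ∀ s ∈ Set.Icc 0 T, ∀ t ∈ Set.Icc 0 T, dist (γ s) (γ t) ≤ |s - t|)
    (hball : ∀ t ∈ Set.Icc 0 T, Metric.closedBall (γ t) (τ * t) ⊆ Ω) {s η : ℝ} (hs : 0 ≤ s)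
    (hη : 0 < η) (hmor : ∀ t ∈ Set.Ioc 0 T,
      ∫ z in Metric.closedBall (γ t) (τ * t), ‖fderiv ℝ u z‖ ≤
        s * (τ * t) ^ ((n : ℝ) - 1 + η)) :
    volume.real (Metric.closedBall (0 : EuclideanSpace ℝ (Fin n)) 1) * |u (γ 0) -
      (volume.real (Metric.closedBall (0 : EuclideanSpace ℝ (Fin n)) 1))⁻¹ *
        ∫ z in Metric.closedBall (0 : EuclideanSpace ℝ (Fin n)) 1, u (γ T + (τ * T) • z)| ≤
      (1 + τ) * s * (τ * T) ^ η / (τ * η) := by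
  set ω := volume.real (Metric.closedBall (0 : EuclideanSpace ℝ (Fin n)) 1) with hω
  have hω0 : 0 < ω := ENNReal.toReal_pos
    (Metric.measure_closedBall_pos volume _ one_pos).ne' measure_closedBall_lt_top.ne
  set φ : ℝ → ℝ := fun t => ∫ z in Metric.closedBall (0 : EuclideanSpace ℝ (Fin n)) 1,
      u (γ t + (τ * t) • z) with hφ
  have hφ0 : φ 0 = ω * u (γ 0) := by simp [hφ, hω]
  -- `B` is the primitive of the rate `(1 + τ) s (τ t)^(η-1)` permitted by the Morrey condition.
  set B : ℝ → ℝ := fun t => (1 + τ) * s * (τ * t) ^ η / (τ * η) with hB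
  have hγc : ContinuousOn γ (Set.Icc 0 T) := by
    refine (LipschitzOnWith.of_dist_le_mul (K := 1) fun x hx y hy => ?_).continuousOn
    simpa [Real.dist_eq] using hγ x hx y hy
  have hφc : ContinuousOn φ (Set.Icc 0 T) :=
    continuousOn_integral_moving_ball hu.continuousOn hτ.le hγc hball
  have hBc : Continuous B := by
    have : Continuous fun t : ℝ => (τ * t) ^ η :=
      (Real.continuous_rpow_const hη.le).comp (by fun_prop)
    exact (this.const_mul _).div_const _
  have hBd : ∀ t, 0 < t → HasDerivAt B ((1 + τ) * s * (τ * t) ^ (η - 1)) t := by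
    intro t ht
    have h1 : HasDerivAt (fun t : ℝ => τ * t) τ t := by simpa using (hasDerivAt_id t).const_mul τ
    have h2 := h1.rpow_const (p := η) (Or.inl (mul_pos hτ ht).ne')
    refine ((h2.const_mul ((1 + τ) * s)).div_const (τ * η)).congr_deriv ?_
    field_simp
  have hslope : ∀ t ∈ Set.Ioo 0 T, ∀ r, (1 + τ) * s * (τ * t) ^ (η - 1) < r →
      ∀ᶠ v in nhdsWithin t (Set.Ioi t), |φ v - φ t| ≤ r * (v - t) := by
    intro t ht r hr
    refine eventually_abs_sub_integral_moving_ball_le hΩ hu hτ hγ hball ht.1 ht.2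
      (lt_of_le_of_lt ?_ hr)
    have hρ : 0 < τ * t := mul_pos hτ ht.1
    calc _ ≤ (1 + τ) * ((τ * t) ^ n)⁻¹ * (s * (τ * t) ^ ((n : ℝ) - 1 + η)) := by
          gcongr; exact hmor t ⟨ht.1, ht.2.le⟩
      _ = _ := by
        rw [← Real.rpow_natCast, ← Real.rpow_neg hρ.le]
        have : (τ * t) ^ (η - 1) = (τ * t) ^ (-(n : ℝ)) * (τ * t) ^ ((n : ℝ) - 1 + η) := by
          rw [← Real.rpow_add hρ]; congr 1; ring
        rw [this]; ring
  -- `B` need not be differentiable at `0` when `η < 1`, so the comparison starts at `a > 0`, and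
  -- `a` tends to `0` afterwards. The signs `±1` give the absolute value.
  have hsign : ∀ σ : ℝ, |σ| = 1 → ∀ a ∈ Set.Ioo 0 T, σ * φ T - σ * φ a ≤ B T - B a := by
    intro σ hσ a ha
    have hsub : Set.Icc a T ⊆ Set.Icc 0 T := Set.Icc_subset_Icc_left ha.1.le
    have := image_le_of_liminf_slope_right_le_deriv_boundary (f := fun t => σ * φ t - σ * φ a)
      (B := fun t => B t - B a) (a := a) (b := T)
      (((hφc.mono hsub).const_mul σ |>.sub continuousOn_const)) (by simp)
      (hBc.continuousOn.sub continuousOn_const)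
      (fun t ht => ((hBd t (ha.1.trans_le ht.1)).sub_const _).hasDerivWithinAt)
      (fun t ht r hr => by
        obtain ⟨r', hr', hrr'⟩ := exists_between hr
        refine Filter.Eventually.frequently ?_
        filter_upwards [hslope t ⟨ha.1.trans_le ht.1, ht.2⟩ r' hr', self_mem_nhdsWithin]
          with v hv hvt
        have hvt' : 0 < v - t := sub_pos.2 hvt
        refine lt_of_le_of_lt ?_ hrr'
        rw [slope_def_field, div_le_iff₀ hvt']
        refine le_trans ?_ hv
        calc _ = σ * (φ v - φ t) := by ring
          _ ≤ |σ * (φ v - φ t)| := le_abs_self _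
          _ = _ := by rw [abs_mul, hσ, one_mul])
      (x := T) (Set.right_mem_Icc.2 ha.2.le)
    exact this
  have habs : |φ T - φ 0| ≤ B T := by
    rcases hT.eq_or_lt with rfl | hT0
    · simp only [sub_self, abs_zero, hB]; positivity
    have hle : ∀ σ : ℝ, |σ| = 1 → σ * φ T - σ * φ 0 ≤ B T - B 0 := by
      intro σ hσ
      have h0m : (0 : ℝ) ∈ Set.Icc 0 T := ⟨le_rfl, hT⟩
      have hmem : Set.Ioo 0 T ∈ nhdsWithin (0 : ℝ) (Set.Ioi 0) := Ioo_mem_nhdsGT hT0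
      have hφ1 : Filter.Tendsto φ (nhdsWithin 0 (Set.Ioi 0)) (nhds (φ 0)) :=
        (hφc 0 h0m).mono_left <| le_inf inf_le_left (by
          simpa using Filter.mem_of_superset hmem Set.Ioo_subset_Icc_self)
      have hB1 : Filter.Tendsto B (nhdsWithin 0 (Set.Ioi 0)) (nhds (B 0)) :=
        (hBc.tendsto 0).mono_left inf_le_left
      exact le_of_tendsto_of_tendsto (tendsto_const_nhds.sub (hφ1.const_mul σ))
        (tendsto_const_nhds.sub hB1) (Filter.mem_of_superset hmem fun a ha => hsign σ hσ a ha)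
    have hB0 : B 0 = 0 := by simp [hB, Real.zero_rpow hη.ne']
    have h1 := hle 1 (by simp)
    have h2 := hle (-1) (by simp)
    rw [abs_le]
    constructor <;> linarith
  calc ω * |u (γ 0) - ω⁻¹ * φ T| = |ω * (u (γ 0) - ω⁻¹ * φ T)| := by
        rw [abs_mul, abs_of_pos hω0]
    _ = |φ T - φ 0| := by
        rw [mul_sub, mul_inv_cancel_left₀ hω0.ne', ← hφ0, abs_sub_comm]
    _ ≤ _ := habs

end Oscillation

/-! ### From large gradient integrals to small content. -/

theorem ENNReal.rpow_tsum_le_tsum_rpow {ι : Type*} (f : ι → ℝ≥0∞) {p : ℝ} (hp : 0 < p)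
    (hp1 : p ≤ 1) : (∑' i, f i) ^ p ≤ ∑' i, f i ^ p := by
  rw [← ENNReal.le_rpow_inv_iff hp]
  rw [ENNReal.tsum_eq_iSup_sum]
  refine iSup_le fun s => ?_
  rw [ENNReal.le_rpow_inv_iff hp]
  refine le_trans ?_ (ENNReal.sum_le_tsum s)
  classical
  induction s using Finset.induction_on with
  | empty => simp [hp]
  | insert a s ha ih =>
    rw [Finset.sum_insert ha, Finset.sum_insert ha]
    exact (ENNReal.rpow_add_le_add_rpow _ _ hp.le hp1).trans (by gcongr)

/-- A geometric series of ratio at most `1/2` is at most twice its top term. -/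
theorem tsum_zpow_of_le {θ A : ℝ} (hθ : 2 ≤ θ) (hA : 0 < A) :
    ∑' k : ℤ, (if θ ^ k ≤ A then ENNReal.ofReal (θ ^ k) else 0) ≤ ENNReal.ofReal (2 * A) := by
  have hθ0 : 0 < θ := by linarith
  have hθ1 : 1 < θ := by linarith
  obtain ⟨k₀, hk₀⟩ := exists_mem_Ico_zpow hA hθ1
  have hinj : Function.Injective fun i : ℕ => k₀ - (i : ℤ) := fun i j h => by
    simpa using h
  rw [← hinj.tsum_eq]
  · calc _ ≤ ∑' i : ℕ, ENNReal.ofReal A * 2⁻¹ ^ i := by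
          refine ENNReal.tsum_le_tsum fun i => ?_
          have h1 : θ ^ (k₀ - (i : ℤ)) ≤ A * 2⁻¹ ^ i := by
            rw [zpow_sub₀ hθ0.ne', zpow_natCast, div_eq_mul_inv, ← inv_pow]
            gcongr
            exact hk₀.1
          split_ifs
          · refine (ENNReal.ofReal_le_ofReal h1).trans (le_of_eq ?_)
            rw [ENNReal.ofReal_mul hA.le, ENNReal.ofReal_pow (by norm_num),
              ENNReal.ofReal_inv_of_pos two_pos, ENNReal.ofReal_ofNat]
          · exact zero_le
      _ = _ := by
        rw [ENNReal.tsum_mul_left, ENNReal.tsum_geometric, ENNReal.one_sub_inv_two, inv_inv,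
          mul_comm, ENNReal.ofReal_mul zero_le_two, ENNReal.ofReal_ofNat]
  · intro k hk
    have hkA : θ ^ k ≤ A := by
      by_contra h
      exact hk (if_neg h)
    have : k < k₀ + 1 := (zpow_lt_zpow_iff_right₀ hθ1).1 (hkA.trans_lt hk₀.2)
    exact ⟨(k₀ - k).toNat, by simp only; omega⟩

section WeakType

variable {n : ℕ}

/-- A set of points at which a finite measure has large density on some ball has small content. -/
theorem hausdorffContent_le_of_density {δ D v C W : ℝ} (hD : 0 < D) (hDδ : D ≤ δ) (hv : 0 < v)
    (hC : 0 < C) (hW : 0 < W) (μ : Measure (EuclideanSpace ℝ (Fin n)))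
    (hμ : μ Set.univ ≤ ENNReal.ofReal W) {A : Set (EuclideanSpace ℝ (Fin n))}
    (hA : ∀ x ∈ A, ∃ r, 0 < r ∧ ENNReal.ofReal (v * r ^ D) < μ (Metric.closedBall x (C * r))) :
    hausdorffContent δ A ≤ ENNReal.ofReal ((6 * C) ^ δ * (W / v) ^ (δ / D)) := by
  have hδ : 0 < δ := hD.trans_le hDδ
  choose! r hr0 hr using hA
  have hbound : ∀ x ∈ A, v * r x ^ D ≤ W := fun x hx => by
    have := (hr x hx).le.trans ((measure_mono (Set.subset_univ _)).trans hμ)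
    rwa [ENNReal.ofReal_le_ofReal_iff hW.le] at this
  have hpow : ∀ x ∈ A, r x ^ D ≤ W / v := fun x hx => by
    rw [le_div_iff₀ hv, mul_comm]; exact hbound x hx
  obtain ⟨t, htA, htd, htc⟩ := Vitali.exists_disjoint_subfamily_covering_enlargement_closedBall A
    id (fun x => C * r x) (C * (W / v) ^ (1 / D)) (fun x hx => by
      gcongr
      have := Real.rpow_le_rpow (Real.rpow_nonneg (hr0 x hx).le _) (hpow x hx) (one_div_pos.2 hD).le
      rwa [← Real.rpow_mul (hr0 x hx).le, mul_one_div_cancel hD.ne', Real.rpow_one] at this)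
    5 (by norm_num)
  have htcount : t.Countable := htd.countable_of_nonempty_interior fun x hx =>
    ⟨x, Metric.ball_subset_interior_closedBall
      (Metric.mem_ball_self (mul_pos hC (hr0 x (htA hx))))⟩
  have : Countable t := htcount.to_subtype
  -- Write `r^δ = r^D (r^D)^(δ/D - 1)`: the density controls the first factor, the total mass the
  -- second. Vitali enlarges by 5; 6 makes the covering balls open.
  have hcost : ∀ x ∈ A, ENNReal.ofReal ((6 * (C * r x)) ^ δ) ≤
      ENNReal.ofReal ((6 * C) ^ δ * ((W / v) ^ (δ / D) / W)) *
        μ (Metric.closedBall x (C * r x)) := by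
    intro x hx
    refine le_trans ?_ (mul_le_mul_right (hr x hx).le _)
    rw [← ENNReal.ofReal_mul (by positivity)]
    refine ENNReal.ofReal_le_ofReal ?_
    have hrx := hr0 x hx
    have h1 : r x ^ δ = r x ^ D * (r x ^ D) ^ (δ / D - 1) := by
      rw [← Real.rpow_mul hrx.le, ← Real.rpow_add hrx]; congr 1; field_simp; ring
    have h2 : (r x ^ D) ^ (δ / D - 1) ≤ (W / v) ^ (δ / D - 1) :=
      Real.rpow_le_rpow (by positivity) (hpow x hx) (sub_nonneg.2 ((one_le_div hD).2 hDδ))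
    calc _ = (6 * C) ^ δ * r x ^ δ := by rw [← mul_assoc, Real.mul_rpow (by positivity) hrx.le]
      _ ≤ (6 * C) ^ δ * (r x ^ D * (W / v) ^ (δ / D - 1)) := by rw [h1]; gcongr
      _ = _ := by
        rw [Real.rpow_sub_one (by positivity)]
        field_simp
  calc hausdorffContent δ A ≤ ∑' x : t, ENNReal.ofReal ((6 * (C * r x)) ^ δ) := by
        refine hausdorffContent_le_tsum hδ (fun x : t => (x : EuclideanSpace ℝ (Fin n))) _
          (fun x => by have := hr0 x (htA x.2); positivity) fun x hx => ?_
        obtain ⟨b, hb, hxb⟩ := htc x hx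
        have hbpos := mul_pos hC (hr0 b (htA hb))
        refine Set.mem_iUnion.2 ⟨⟨b, hb⟩, ?_⟩
        exact Metric.closedBall_subset_ball (by linarith)
          (hxb (Metric.mem_closedBall_self (mul_pos hC (hr0 x hx)).le))
    _ ≤ ∑' x : t, ENNReal.ofReal ((6 * C) ^ δ * ((W / v) ^ (δ / D) / W)) *
        μ (Metric.closedBall x (C * r x)) := ENNReal.tsum_le_tsum fun x => hcost x (htA x.2)
    _ ≤ ENNReal.ofReal ((6 * C) ^ δ * ((W / v) ^ (δ / D) / W)) * ENNReal.ofReal W := by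
      rw [ENNReal.tsum_mul_left]
      gcongr
      refine le_trans ?_ hμ
      exact tsum_measure_le_measure_univ
        (fun _ => Metric.isClosed_closedBall.measurableSet.nullMeasurableSet)
        fun a b hab => (htd a.2 b.2 fun h => hab (Subtype.ext h)).aedisjoint
    _ = _ := by
      rw [← ENNReal.ofReal_mul (by positivity)]
      congr 1
      field_simp

/-- The volume of the part of a union of balls inside a given ball: either one of the balls is
larger than the given one, or volumes add up. -/
theorem volume_iUnion_ball_inter_closedBall_le {x : ℕ → EuclideanSpace ℝ (Fin n)} {l : ℕ → ℝ}
    (hl : ∀ j, 0 < l j) (B : Set (EuclideanSpace ℝ (Fin n))) (ρ : ℝ) {P : Prop} [Decidable P]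
    (hP : ∀ j, ρ < l j → (Metric.ball (x j) (l j) ∩ B).Nonempty → P)
    [∀ j, Decidable (l j ≤ ρ ∧ (Metric.ball (x j) (l j) ∩ B).Nonempty)] :
    volume ((⋃ j, Metric.ball (x j) (l j)) ∩ B) ≤ (if P then volume B else 0) +
      ∑' j, if l j ≤ ρ ∧ (Metric.ball (x j) (l j) ∩ B).Nonempty then
        ENNReal.ofReal (l j ^ n) * volume (Metric.closedBall (0 : EuclideanSpace ℝ (Fin n)) 1)
        else 0 := by
  split_ifs with h
  · exact (measure_mono Set.inter_subset_right).trans le_self_add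
  · rw [zero_add, Set.iUnion_inter]
    refine (measure_iUnion_le _).trans (ENNReal.tsum_le_tsum fun j => ?_)
    split_ifs with hj
    · have := Measure.addHaar_closedBall' volume (x j) (hl j).le
      rw [finrank_euclideanSpace_fin] at this
      rw [← this]
      exact measure_mono (Set.inter_subset_left.trans Metric.ball_subset_closedBall)
    · rw [not_and] at hj
      refine le_of_eq ?_
      rw [(Set.not_nonempty_iff_eq_empty (s := Metric.ball (x j) (l j) ∩ B)).1, measure_empty]
      intro hne
      rcases lt_or_ge ρ (l j) with h1 | h1
      · exact h (hP j h1 hne)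
      · exact hj h1 hne

variable (x : ℤ → ℕ → EuclideanSpace ℝ (Fin n)) (l : ℤ → ℕ → ℝ)

open Classical in
/-- If the integral over a ball of a function dominated by a sum over level covers is large, then
either some large covering ball carries a high level, or the small covering balls carry a
proportional part of the integral. -/
theorem exists_large_ball_or_lt_tsum (hl : ∀ k j, 0 < l k j) {θ A : ℝ} (hθ : 2 ≤ θ) (hA : 0 < A)
    {g : EuclideanSpace ℝ (Fin n) → ℝ≥0∞} (y : EuclideanSpace ℝ (Fin n)) {ρ : ℝ} (hρ : 0 < ρ)
    (hg : ∀ z ∈ Metric.closedBall y ρ, g z ≤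
      ∑' k : ℤ, (⋃ j, Metric.ball (x k j) (l k j)).indicator
        (fun _ => ENNReal.ofReal (θ ^ (k + 1))) z)
    (hlt : ENNReal.ofReal (4 * A * ρ ^ n *
      volume.real (Metric.closedBall (0 : EuclideanSpace ℝ (Fin n)) 1)) <
        ∫⁻ z in Metric.closedBall y ρ, g z) :
    (∃ k j, ρ < l k j ∧ (Metric.ball (x k j) (l k j) ∩ Metric.closedBall y ρ).Nonempty ∧
      A < θ ^ (k + 1)) ∨
    ENNReal.ofReal (A * ρ ^ n) <
      ∑' (k : ℤ) (j : ℕ), if l k j ≤ ρ ∧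
        (Metric.ball (x k j) (l k j) ∩ Metric.closedBall y ρ).Nonempty then
          ENNReal.ofReal (θ ^ (k + 1) * l k j ^ n) else 0 := by
  by_contra! hcon
  obtain ⟨hbig, hsmall⟩ := hcon
  set B := Metric.closedBall y ρ with hB
  set V := volume (Metric.closedBall (0 : EuclideanSpace ℝ (Fin n)) 1) with hV
  have hVtop : V ≠ ∞ := measure_closedBall_lt_top.ne
  have hVreal : ENNReal.ofReal (volume.real (Metric.closedBall (0 : EuclideanSpace ℝ (Fin n)) 1)) =
      V := ENNReal.ofReal_toReal hVtop
  have hBV : volume B = ENNReal.ofReal (ρ ^ n) * V := by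
    have := Measure.addHaar_closedBall' volume y hρ.le
    rwa [finrank_euclideanSpace_fin] at this
  have hθ0 : 0 < θ := by linarith
  refine absurd hlt (not_lt.2 ?_)
  calc ∫⁻ z in B, g z
      ≤ ∫⁻ z in B, ∑' k : ℤ, (⋃ j, Metric.ball (x k j) (l k j)).indicator
        (fun _ => ENNReal.ofReal (θ ^ (k + 1))) z :=
        setLIntegral_mono' Metric.isClosed_closedBall.measurableSet hg
    _ = ∑' k : ℤ, ENNReal.ofReal (θ ^ (k + 1)) *
          volume ((⋃ j, Metric.ball (x k j) (l k j)) ∩ B) := by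
      have hm : ∀ k, MeasurableSet (⋃ j, Metric.ball (x k j) (l k j)) := fun k =>
        MeasurableSet.iUnion fun j => Metric.isOpen_ball.measurableSet
      rw [lintegral_tsum fun k => (measurable_const.indicator (hm k)).aemeasurable]
      refine tsum_congr fun k => ?_
      rw [lintegral_indicator_const (hm k), Measure.restrict_apply (hm k)]
    -- On levels above `A` only balls of radius at most `ρ` meet `B`, by `hbig`; on lower levels all
    -- of `B` is conceded, and the levels sum to at most `2 * A`.
    _ ≤ ∑' k : ℤ, ((if θ ^ (k + 1) ≤ A then ENNReal.ofReal (θ ^ (k + 1)) else 0) * volume B +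
          (∑' j, if l k j ≤ ρ ∧ (Metric.ball (x k j) (l k j) ∩ B).Nonempty then
            ENNReal.ofReal (θ ^ (k + 1) * l k j ^ n) else 0) * V) := by
      refine ENNReal.tsum_le_tsum fun k => ?_
      refine (mul_le_mul_right (volume_iUnion_ball_inter_closedBall_le (hl k) B ρ
        (P := θ ^ (k + 1) ≤ A) fun j h1 h2 => hbig k j h1 h2) _).trans (le_of_eq ?_)
      rw [mul_add, ← ENNReal.tsum_mul_left, ← ENNReal.tsum_mul_right]
      congr 1
      · split_ifs <;> simp
      · refine tsum_congr fun j => ?_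
        split_ifs
        · rw [ENNReal.ofReal_mul (by positivity), mul_assoc]
        · simp
    _ ≤ ENNReal.ofReal (2 * A) * volume B + ENNReal.ofReal (A * ρ ^ n) * V := by
      rw [ENNReal.tsum_add, ENNReal.tsum_mul_right, ENNReal.tsum_mul_right]
      gcongr
      have := (Equiv.addRight (1 : ℤ)).tsum_eq
        fun k : ℤ => if θ ^ k ≤ A then ENNReal.ofReal (θ ^ k) else 0
      simp only [Equiv.coe_addRight] at this
      have hsum := tsum_zpow_of_le hθ hA
      rw [← this] at hsum
      refine (le_of_eq (tsum_congr fun k => ?_)).trans hsum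
      by_cases hk : θ ^ (k + 1) ≤ A <;> simp [hk]
    _ = ENNReal.ofReal (3 * A * ρ ^ n) * V := by
      rw [hBV, ← mul_assoc, ← ENNReal.ofReal_mul (by positivity), ← add_mul,
        ← ENNReal.ofReal_add (by positivity) (by positivity)]
      ring_nf
    _ ≤ _ := by
      rw [ENNReal.ofReal_mul (p := 4 * A * ρ ^ n) (by positivity), hVreal]
      gcongr
      norm_num

/-- The weighted counting measure on the centres of the covering balls. -/
noncomputable def coverMeasure (d : ℝ) : Measure (EuclideanSpace ℝ (Fin n)) :=
  Measure.sum fun q : ℤ × ℕ =>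
    ENNReal.ofReal (2 ^ (q.1 + 1) * l q.1 q.2 ^ d) • Measure.dirac (x q.1 q.2)

open Classical in
theorem coverMeasure_apply (d : ℝ) {S : Set (EuclideanSpace ℝ (Fin n))} (hS : MeasurableSet S) :
    coverMeasure x l d S = ∑' (k : ℤ) (j : ℕ),
      if x k j ∈ S then ENNReal.ofReal (2 ^ (k + 1) * l k j ^ d) else 0 := by
  rw [coverMeasure, Measure.sum_apply _ hS, ENNReal.tsum_prod']
  refine tsum_congr fun k => tsum_congr fun j => ?_
  simp [Measure.dirac_apply' _ hS, Set.indicator_apply]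

/-- Apply the dichotomy at height `A = s ρ^(η-1)`. A large covering ball is itself the mass sought,
at scale `r = l k j`. Otherwise take `r = ρ`: raising the sum to the power `p = δ/n ≤ 1` termwise
turns `θ^(k+1) l^n` into `2^(k+1) l^δ`, and `l^δ ≤ l^(δ-ε) ρ^ε` because `l ≤ ρ`. -/
theorem exists_density_of_lt_lintegral (hl : ∀ k j, 0 < l k j) (hn : 0 < n) {δ ε η τ s : ℝ}
    (hδ : 0 < δ) (hδn : δ ≤ n) (hε : 0 < ε) (hη : η ≤ 1) (hτ : 0 < τ) (hs : 0 < s)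
    {g : EuclideanSpace ℝ (Fin n) → ℝ≥0∞} (y z : EuclideanSpace ℝ (Fin n)) {ρ : ℝ} (hρ : 0 < ρ)
    (hz : dist z y ≤ ρ / τ)
    (hg : ∀ z ∈ Metric.closedBall y ρ, g z ≤
      ∑' k : ℤ, (⋃ j, Metric.ball (x k j) (l k j)).indicator
        (fun _ => ENNReal.ofReal (((2 : ℝ) ^ ((n : ℝ) / δ)) ^ (k + 1))) z)
    (hlt : ENNReal.ofReal (4 * s * volume.real (Metric.closedBall (0 : EuclideanSpace ℝ (Fin n)) 1) *
      ρ ^ ((n : ℝ) - 1 + η)) < ∫⁻ z in Metric.closedBall y ρ, g z) :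
    ∃ r, 0 < r ∧ ENNReal.ofReal (s ^ (δ / n) * r ^ (δ - ε - δ / n * (1 - η))) <
      coverMeasure x l (δ - ε) (Metric.closedBall z ((1 / τ + 3) * r)) := by
  classical
  have hn0 : (0 : ℝ) < n := by exact_mod_cast hn
  set p := δ / n with hp
  have hp0 : 0 < p := by positivity
  have hp1 : p ≤ 1 := (div_le_one hn0).2 hδn
  have hpn : n * p = δ := by rw [hp]; field_simp
  set θ : ℝ := 2 ^ ((n : ℝ) / δ) with hθdef
  have hθ : 2 ≤ θ := by
    rw [hθdef]
    exact Real.self_le_rpow_of_one_le one_le_two ((one_le_div hδ).2 hδn)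
  have hθ0 : 0 < θ := by linarith
  have hθp : ∀ k : ℤ, (θ ^ k) ^ p = 2 ^ k := fun k => by
    rw [← Real.rpow_intCast, ← Real.rpow_intCast, hθdef, ← Real.rpow_mul (by positivity),
      ← Real.rpow_mul (by positivity)]
    congr 1
    rw [hp]; field_simp
  have hA : 0 < s * ρ ^ (η - 1) := by positivity
  have hmeas : MeasurableSet (Metric.closedBall z ((1 / τ + 3) * ρ)) :=
    Metric.isClosed_closedBall.measurableSet
  have hAp : ∀ r : ℝ, 0 < r → (s * r ^ (η - 1)) ^ p * r ^ (δ - ε) =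
      s ^ p * r ^ (δ - ε - p * (1 - η)) := fun r hr => by
    rw [Real.mul_rpow hs.le (by positivity), ← Real.rpow_mul hr.le, mul_assoc, ← Real.rpow_add hr]
    congr 2; ring
  have hlt' : 4 * (s * ρ ^ (η - 1)) * ρ ^ n *
      volume.real (Metric.closedBall (0 : EuclideanSpace ℝ (Fin n)) 1) =
      4 * s * volume.real (Metric.closedBall (0 : EuclideanSpace ℝ (Fin n)) 1) *
        ρ ^ ((n : ℝ) - 1 + η) := by
    have : ρ ^ ((n : ℝ) - 1 + η) = ρ ^ (η - 1) * ρ ^ n := by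
      rw [← Real.rpow_natCast, ← Real.rpow_add hρ]; congr 1; ring
    rw [this]; ring
  rcases exists_large_ball_or_lt_tsum x l hl hθ hA y hρ hg (by rwa [hlt']) with
    ⟨k, j, hρl, ⟨w, hwx, hwy⟩, hk⟩ | h
  · have hl0 := hl k j
    refine ⟨l k j, hl0, ?_⟩
    have hmem : x k j ∈ Metric.closedBall z ((1 / τ + 3) * l k j) := by
      rw [Metric.mem_closedBall, dist_comm]
      have h1 : ρ / τ ≤ l k j / τ := by gcongr
      calc dist z (x k j) ≤ dist z y + dist y w + dist w (x k j) := dist_triangle4 _ _ _ _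
        _ ≤ l k j / τ + l k j + l k j := by
          rw [Metric.mem_ball] at hwx
          rw [Metric.mem_closedBall, dist_comm] at hwy
          linarith
        _ ≤ _ := by rw [add_mul, one_div_mul_eq_div]; linarith
    rw [coverMeasure_apply x l _ Metric.isClosed_closedBall.measurableSet]
    refine lt_of_lt_of_le ?_ ((ENNReal.le_tsum j).trans (ENNReal.le_tsum k))
    rw [if_pos hmem, ENNReal.ofReal_lt_ofReal_iff (by positivity), ← hAp _ hl0, ← hθp]
    gcongr
    refine lt_of_le_of_lt ?_ hk
    gcongr 1
    -- Since `η ≤ 1`, the threshold `s r^(η-1)` does not increase when `r` grows from `ρ` to `l k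
    -- j`.
    exact Real.rpow_le_rpow_of_nonpos hρ hρl.le (by linarith)
  · refine ⟨ρ, hρ, ?_⟩
    rw [coverMeasure_apply x l _ hmeas]
    have h2 := ENNReal.rpow_lt_rpow h hp0
    have h3 : ENNReal.ofReal ((s * ρ ^ (η - 1)) ^ p * ρ ^ δ) <
        ∑' (k : ℤ) (j : ℕ), if l k j ≤ ρ ∧
          (Metric.ball (x k j) (l k j) ∩ Metric.closedBall y ρ).Nonempty then
            ENNReal.ofReal (2 ^ (k + 1) * l k j ^ δ) else 0 := by
      rw [ENNReal.ofReal_rpow_of_nonneg (by positivity) hp0.le,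
        Real.mul_rpow hA.le (by positivity), ← Real.rpow_natCast, ← Real.rpow_mul hρ.le, hpn] at h2
      refine h2.trans_le ((ENNReal.rpow_tsum_le_tsum_rpow _ hp0 hp1).trans
        (ENNReal.tsum_le_tsum fun k => (ENNReal.rpow_tsum_le_tsum_rpow _ hp0 hp1).trans
          (ENNReal.tsum_le_tsum fun j => ?_)))
      split_ifs
      · have := hl k j
        rw [ENNReal.ofReal_rpow_of_nonneg (by positivity) hp0.le,
          Real.mul_rpow (by positivity) (by positivity), hθp, ← Real.rpow_natCast,
          ← Real.rpow_mul this.le, hpn]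
      · rw [ENNReal.zero_rpow_of_pos hp0]
    have hρε : ENNReal.ofReal (ρ ^ ε) ≠ 0 := by
      simpa using Real.rpow_pos_of_pos hρ ε
    have h4 : ∑' (k : ℤ) (j : ℕ), (if l k j ≤ ρ ∧
          (Metric.ball (x k j) (l k j) ∩ Metric.closedBall y ρ).Nonempty then
            ENNReal.ofReal (2 ^ (k + 1) * l k j ^ δ) else 0) ≤
        (∑' (k : ℤ) (j : ℕ), if x k j ∈ Metric.closedBall z ((1 / τ + 3) * ρ) then
          ENNReal.ofReal (2 ^ (k + 1) * l k j ^ (δ - ε)) else 0) * ENNReal.ofReal (ρ ^ ε) := by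
      rw [← ENNReal.tsum_mul_right]
      refine ENNReal.tsum_le_tsum fun k => ?_
      rw [← ENNReal.tsum_mul_right]
      refine ENNReal.tsum_le_tsum fun j => ?_
      have hl0 := hl k j
      split_ifs with h1 h5
      · rw [← ENNReal.ofReal_mul (by positivity)]
        refine ENNReal.ofReal_le_ofReal ?_
        rw [mul_assoc]
        gcongr
        calc l k j ^ δ = l k j ^ (δ - ε) * l k j ^ ε := by
              rw [← Real.rpow_add hl0]; congr 1; ring
          _ ≤ _ := by gcongr; exact h1.1
      · exfalso
        obtain ⟨hlρ, w, hwx, hwy⟩ := h1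
        refine h5 ?_
        rw [Metric.mem_closedBall, dist_comm]
        calc dist z (x k j) ≤ dist z y + dist y w + dist w (x k j) := dist_triangle4 _ _ _ _
          _ ≤ ρ / τ + ρ + ρ := by
            rw [Metric.mem_ball] at hwx
            rw [Metric.mem_closedBall, dist_comm] at hwy
            linarith
          _ ≤ _ := by rw [add_mul, one_div_mul_eq_div]; linarith
      · exact zero_le
      · exact zero_le
    have h5 := h3.trans_le h4
    have h6 : (s * ρ ^ (η - 1)) ^ p * ρ ^ δ = s ^ p * ρ ^ (δ - ε - p * (1 - η)) * ρ ^ ε := by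
      rw [← hAp ρ hρ, mul_assoc, ← Real.rpow_add hρ]; congr 2; ring
    rw [h6, ENNReal.ofReal_mul (by positivity)] at h5
    exact lt_of_mul_lt_mul_right' h5

end WeakType

/-! ### John domains, choice of exponents and conclusion. -/

section JohnDomain

variable {n : ℕ}

/-- On a John domain, wherever a `C¹` function is far from a suitable constant, its gradient has a
large integral over some comparable ball inside the domain. -/
theorem exists_lt_integral_fderiv_of_isBoundedJohnDomain {α β η : ℝ} (hα : 0 < α) (hβ : 0 < β)
    (hη : 0 < η) : ∃ c, 0 < c ∧
      ∀ Ω : Set (EuclideanSpace ℝ (Fin n)), IsBoundedJohnDomain α β Ω →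
        ∀ u : EuclideanSpace ℝ (Fin n) → ℝ, ContDiffOn ℝ 1 u Ω →
          ∃ b : ℝ, ∀ x ∈ Ω, ∀ s, 0 < s → s < |u x - b| →
            ∃ y ρ, 0 < ρ ∧ dist x y ≤ ρ / (α / (2 * β)) ∧ Metric.closedBall y ρ ⊆ Ω ∧
              c * s * ρ ^ ((n : ℝ) - 1 + η) < ∫ z in Metric.closedBall y ρ, ‖fderiv ℝ u z‖ := by
  set ω := volume.real (Metric.closedBall (0 : EuclideanSpace ℝ (Fin n)) 1) with hω
  have hω0 : 0 < ω := ENNReal.toReal_pos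
    (Metric.measure_closedBall_pos volume _ one_pos).ne' measure_closedBall_lt_top.ne
  set τ := α / (2 * β) with hτdef
  have hτ : 0 < τ := by positivity
  refine ⟨ω * (τ * η) / ((1 + τ) * (τ * β) ^ η), by positivity, fun Ω hΩ u hu => ?_⟩
  set c := ω * (τ * η) / ((1 + τ) * (τ * β) ^ η) with hc
  have hc0 : 0 < c := by positivity
  obtain ⟨x₀, hx₀, hjoin⟩ := hΩ.exists_center
  set d := Metric.infDist x₀ (frontier Ω) with hd
  -- `T` does not depend on `x`, so all curves end at the same ball and give the same `b`. A curve
  -- is frozen at `x₀` after time `ℓ`; `T ≤ d * β / α` preserves the John condition there.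
  set T := min β (d * β / α) with hT
  have hT0 : 0 ≤ T := le_min hβ.le (by have := Metric.infDist_nonneg (x := x₀) (s := frontier Ω)
                                       positivity)
  refine ⟨ω⁻¹ * ∫ z in Metric.closedBall (0 : EuclideanSpace ℝ (Fin n)) 1, u (x₀ + (τ * T) • z),
    fun x hx s hs hsu => ?_⟩
  obtain ⟨ℓ, γ, hℓ0, hℓβ, hspeed, hmaps, hγ0, hγℓ, hdist⟩ := hjoin x hx
  have hℓT : ℓ ≤ T := by
    refine le_min hℓβ ?_
    have := hdist ℓ ⟨hℓ0, le_rfl⟩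
    rw [hγℓ] at this
    rw [le_div_iff₀ hα]
    calc ℓ * α = α / β * ℓ * β := by field_simp
      _ ≤ d * β := by gcongr
  have hmem : ∀ t ∈ Set.Icc 0 T, min t ℓ ∈ Set.Icc 0 ℓ := fun t ht =>
    ⟨le_min ht.1 hℓ0, min_le_right _ _⟩
  have hlip : ∀ r ∈ Set.Icc 0 T, ∀ t ∈ Set.Icc 0 T,
      dist (γ (min r ℓ)) (γ (min t ℓ)) ≤ |r - t| := fun r hr t ht =>
    (hspeed.dist_le (hmem r hr) (hmem t ht)).trans (by
      simpa using abs_min_sub_min_le_max r ℓ t ℓ)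
  have hfar : ∀ t ∈ Set.Icc 0 T, α / β * t ≤ Metric.infDist (γ (min t ℓ)) (frontier Ω) := by
    intro t ht
    rcases le_total t ℓ with h | h
    · rw [min_eq_left h]
      exact hdist t ⟨ht.1, h⟩
    · rw [min_eq_right h, hγℓ]
      calc α / β * t ≤ α / β * (d * β / α) := by
            gcongr; exact ht.2.trans (min_le_right _ _)
        _ = d := by field_simp
  have hball : ∀ t ∈ Set.Icc 0 T, Metric.closedBall (γ (min t ℓ)) (τ * t) ⊆ Ω := by
    intro t ht
    have hΩm := hmaps (hmem t ht)
    rcases ht.1.eq_or_lt with rfl | h0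
    · rw [mul_zero, Metric.closedBall_zero]
      exact Set.singleton_subset_iff.2 hΩm
    · refine closedBall_subset_of_lt_infDist_frontier hΩ.isOpen hΩm (by positivity)
        (lt_of_lt_of_le ?_ (hfar t ht))
      have : α / β * t = 2 * (τ * t) := by rw [hτdef]; field_simp
      rw [this]
      have : 0 < τ * t := by positivity
      linarith
  by_contra! hcon
  have hmor : ∀ t ∈ Set.Ioc 0 T, ∫ z in Metric.closedBall (γ (min t ℓ)) (τ * t), ‖fderiv ℝ u z‖ ≤
      c * s * (τ * t) ^ ((n : ℝ) - 1 + η) := by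
    intro t ht
    have htm : t ∈ Set.Icc 0 T := ⟨ht.1.le, ht.2⟩
    refine hcon _ (τ * t) (mul_pos hτ ht.1) ?_ (hball t htm)
    have := hlip 0 ⟨le_rfl, hT0⟩ t htm
    rw [min_eq_left hℓ0, hγ0, zero_sub, abs_neg, abs_of_pos ht.1] at this
    rwa [mul_div_cancel_left₀ _ hτ.ne']
  have hmain := abs_sub_average_le_of_morrey (γ := fun t => γ (min t ℓ)) hΩ.isOpen hu hτ hT0 hlip
    hball (mul_pos hc0 hs).le hη hmor
  simp only [min_eq_left hℓ0, hγ0, min_eq_right hℓT, hγℓ, ← hω] at hmain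
  refine absurd hmain (not_le.2 (lt_of_le_of_lt ?_ (mul_lt_mul_of_pos_left hsu hω0)))
  calc (1 + τ) * (c * s) * (τ * T) ^ η / (τ * η)
      ≤ (1 + τ) * (c * s) * (τ * β) ^ η / (τ * η) := by
        gcongr; exact min_le_left _ _
    _ = ω * s := by rw [hc]; field_simp

theorem hausdorffContent_le_of_isBoundedJohnDomain {α β δ : ℝ} (hδ : 0 < δ) (hβ : 0 < β)
    {Ω : Set (EuclideanSpace ℝ (Fin n))} (hΩ : IsBoundedJohnDomain α β Ω) :
    hausdorffContent δ Ω ≤ ENNReal.ofReal ((2 * β) ^ δ) := by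
  obtain ⟨x₀, hx₀, hjoin⟩ := hΩ.exists_center
  refine (hausdorffContent_mono fun x hx => ?_).trans
    (hausdorffContent_ball_le hδ x₀ (mul_pos two_pos hβ))
  obtain ⟨ℓ, γ, hℓ0, hℓβ, hspeed, -, hγ0, hγℓ, -⟩ := hjoin x hx
  have := hspeed.dist_le ⟨le_rfl, hℓ0⟩ ⟨hℓ0, le_rfl⟩
  rw [hγ0, hγℓ, zero_sub, abs_neg, abs_of_nonneg hℓ0] at this
  rw [Metric.mem_ball]
  linarith

/-- Nearly optimal covers of the dyadic superlevel sets of a function with finite Choquet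
integral. -/
theorem exists_cover_superlevel {d p W : ℝ} (hp : 0 < p) {Ω : Set (EuclideanSpace ℝ (Fin n))}
    {v : EuclideanSpace ℝ (Fin n) → ℝ} (hv : ∀ y, 0 ≤ v y)
    (hW : 4 * choquetIntegral d Ω (fun y => ENNReal.ofReal (v y ^ p)) < ENNReal.ofReal W) :
    ∃ (x : ℤ → ℕ → EuclideanSpace ℝ (Fin n)) (l : ℤ → ℕ → ℝ), (∀ k j, 0 < l k j) ∧
      coverMeasure x l d Set.univ ≤ ENNReal.ofReal W ∧
      ∀ y ∈ Ω, ENNReal.ofReal (v y) ≤ ∑' k : ℤ, (⋃ j, Metric.ball (x k j) (l k j)).indicator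
        (fun _ => ENNReal.ofReal (((2 : ℝ) ^ (1 / p)) ^ (k + 1))) y := by
  set I := choquetIntegral d Ω fun y => ENNReal.ofReal (v y ^ p) with hI
  set F : ℤ → Set (EuclideanSpace ℝ (Fin n)) := fun k =>
    {y | y ∈ Ω ∧ ENNReal.ofReal (2 ^ k) < ENNReal.ofReal (v y ^ p)} with hF
  have hsum : ∑' k, ENNReal.ofReal (2 ^ k) * hausdorffContent d (F k) ≤ 2 * I :=
    tsum_zpow_mul_hausdorffContent_le d Ω _
  have hItop : I ≠ ∞ := by
    rintro h
    rw [h, ENNReal.mul_top four_ne_zero] at hW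
    exact not_top_lt hW
  have hfin : ∀ k, hausdorffContent d (F k) ≠ ∞ := fun k hk => by
    have h1 := (ENNReal.le_tsum k).trans hsum
    rw [hk, ENNReal.mul_top (by simpa using zpow_pos two_pos k), top_le_iff] at h1
    exact ENNReal.mul_ne_top ENNReal.ofNat_ne_top hItop h1
  -- The covering errors use up the slack `W - 4 * I`. In `4`, one factor 2 comes from the dyadic
  -- lower sums, the other from `2^(k+1)` replacing `2^k`.
  obtain ⟨e, he, hesum⟩ := ENNReal.exists_pos_tsum_mul_lt_of_countable
    (tsub_pos_iff_lt.2 hW).ne' (fun k : ℤ => ENNReal.ofReal (2 ^ (k + 1)))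
    (fun _ => ENNReal.ofReal_ne_top)
  have hlt : ∀ k, hausdorffContent d (F k) < hausdorffContent d (F k) + e k := fun k =>
    ENNReal.lt_add_right (hfin k) (ENNReal.coe_pos.2 (he k)).ne'
  choose x l hl hcov hcost using fun k => exists_cover_of_hausdorffContent_lt (hlt k)
  refine ⟨x, l, hl, ?_, fun y hy => ?_⟩
  · rw [coverMeasure_apply x l d MeasurableSet.univ]
    simp only [Set.mem_univ, if_true]
    calc _ = ∑' k : ℤ, ENNReal.ofReal (2 ^ (k + 1)) * ∑' j, ENNReal.ofReal (l k j ^ d) := by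
          refine tsum_congr fun k => ?_
          rw [← ENNReal.tsum_mul_left]
          exact tsum_congr fun j => ENNReal.ofReal_mul (by positivity)
      _ ≤ ∑' k : ℤ, ENNReal.ofReal (2 ^ (k + 1)) * (hausdorffContent d (F k) + e k) := by
          gcongr with k
          exact (hcost k).le
      _ = 2 * ∑' k, ENNReal.ofReal (2 ^ k) * hausdorffContent d (F k) +
          ∑' k : ℤ, ENNReal.ofReal (2 ^ (k + 1)) * e k := by
          rw [← ENNReal.tsum_mul_left, ← ENNReal.tsum_add]
          refine tsum_congr fun k => ?_
          rw [mul_add, zpow_add_one₀ two_ne_zero, mul_comm ((2 : ℝ) ^ k),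
            ENNReal.ofReal_mul zero_le_two, ENNReal.ofReal_ofNat, mul_assoc]
      _ ≤ 2 * (2 * I) + (ENNReal.ofReal W - 4 * I) := by gcongr
      _ = _ := by
          rw [← mul_assoc, show (2 : ℝ≥0∞) * 2 = 4 by norm_num, add_tsub_cancel_of_le hW.le]
  · rcases (hv y).eq_or_lt with h0 | h0
    · simp [← h0]
    obtain ⟨k, hk⟩ := exists_mem_Ioc_zpow (Real.rpow_pos_of_pos h0 p) (one_lt_two (α := ℝ))
    have hyk : y ∈ ⋃ j, Metric.ball (x k j) (l k j) :=
      hcov k ⟨hy, (ENNReal.ofReal_lt_ofReal_iff (Real.rpow_pos_of_pos h0 p)).2 hk.1⟩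
    refine le_trans ?_ (ENNReal.le_tsum k)
    rw [Set.indicator_of_mem hyk]
    refine ENNReal.ofReal_le_ofReal ?_
    calc v y = (v y ^ p) ^ (1 / p) := by
          rw [← Real.rpow_mul h0.le, mul_one_div_cancel hp.ne', Real.rpow_one]
      _ ≤ ((2 : ℝ) ^ (k + 1)) ^ (1 / p) := by gcongr; exact hk.2
      _ = _ := by
          rw [← Real.rpow_intCast, ← Real.rpow_intCast, ← Real.rpow_mul zero_le_two,
            ← Real.rpow_mul zero_le_two, mul_comm]

/-- The Poincaré–Sobolev inequality with the Choquet integral of the gradient replaced by any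
larger real number. -/
theorem exists_poincareSobolev_const (hn : 2 ≤ n) {α β δ ε : ℝ} (hα : 0 < α) (hβ : 0 < β)
    (hδ : 0 < δ) (hδn : δ ≤ n) (hε : 0 < ε) (hεδ : ε < δ * (1 - 1 / (n : ℝ))) :
    ∃ K, 0 < K ∧ ∀ Ω : Set (EuclideanSpace ℝ (Fin n)), IsBoundedJohnDomain α β Ω →
      ∀ u : EuclideanSpace ℝ (Fin n) → ℝ, ContDiffOn ℝ 1 u Ω → ∃ b : ℝ, ∀ W : ℝ, 0 < W →
        4 * choquetIntegral (δ - ε) Ω (fun x => ENNReal.ofReal (‖fderiv ℝ u x‖ ^ (δ / (n : ℝ)))) <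
          ENNReal.ofReal W →
        (choquetIntegral δ Ω fun x => ENNReal.ofReal (|u x - b| ^ (δ / ((n : ℝ) - 1)))) ^
            (((n : ℝ) - 1) / δ) ≤
          ENNReal.ofReal K * ENNReal.ofReal W ^ ((n : ℝ) / δ) := by
  have hn0 : (0 : ℝ) < n := by exact_mod_cast (by omega : 0 < n)
  have hn1 : (0 : ℝ) < n - 1 := by
    have : (2 : ℝ) ≤ n := by exact_mod_cast hn
    linarith
  set p := δ / n with hp
  have hp0 : 0 < p := by positivity
  have hpn : p * n = δ := by rw [hp]; field_simp
  -- `η > 0` makes the oscillation summable along the curve, and `p * η < ε` gives `δ/(n-1) < σ`.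
  -- The hypothesis `ε < δ(1 - 1/n) = δ - p` gives `D > 0`.
  set η := min 1 (ε / (2 * p)) with hη
  have hη0 : 0 < η := lt_min one_pos (by positivity)
  have hη1 : η ≤ 1 := min_le_left _ _
  have hpη : p * η < ε := by
    calc p * η ≤ p * (ε / (2 * p)) := by gcongr; exact min_le_right _ _
      _ = ε / 2 := by field_simp
      _ < ε := by linarith
  set D := δ - ε - p * (1 - η) with hD
  have hpη0 : 0 < p * η := by positivity
  have hεp : ε < δ - p := by
    rw [mul_sub, mul_one, mul_one_div] at hεδ
    exact hεδ
  have hD0 : 0 < D := by rw [hD, mul_sub, mul_one]; linarith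
  have hDδ : D ≤ δ := by
    have : 0 ≤ p * (1 - η) := mul_nonneg hp0.le (by linarith)
    rw [hD]; linarith
  set σ := p * δ / D with hσ
  have hqσ : δ / ((n : ℝ) - 1) < σ := by
    rw [hσ, div_lt_div_iff₀ hn1 hD0]
    have h1 : D < p * (n - 1) := by rw [hD, mul_sub, mul_sub, mul_one, hpn]; linarith
    calc δ * D < δ * (p * (n - 1)) := by gcongr
      _ = _ := by ring
  set ω := volume.real (Metric.closedBall (0 : EuclideanSpace ℝ (Fin n)) 1) with hω
  have hω0 : 0 < ω := ENNReal.toReal_pos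
    (Metric.measure_closedBall_pos volume _ one_pos).ne' measure_closedBall_lt_top.ne
  obtain ⟨c, hc0, hc⟩ := exists_lt_integral_fderiv_of_isBoundedJohnDomain (n := n) hα hβ hη0
  set τ := α / (2 * β) with hτdef
  have hτ : 0 < τ := by positivity
  -- Absorbs the factor `4 * ω` of `exists_density_of_lt_lintegral`.
  set c₁ := c / (4 * ω) with hc₁
  have hc₁0 : 0 < c₁ := by positivity
  have hq0 : 0 < δ / ((n : ℝ) - 1) := by positivity
  set C := (6 * (1 / τ + 3)) ^ δ * (1 / c₁) ^ σ with hC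
  have hC0 : 0 < C := by positivity
  have hσq : 0 < σ / (δ / ((n : ℝ) - 1)) - 1 := sub_pos.2 ((one_lt_div hq0).2 hqσ)
  refine ⟨((2 * β) ^ δ + C / (σ / (δ / ((n : ℝ) - 1)) - 1)) ^ (1 / (δ / ((n : ℝ) - 1))),
    by positivity, fun Ω hΩ u hu => ?_⟩
  obtain ⟨b, hb⟩ := hc Ω hΩ u hu
  refine ⟨b, fun W hW hIW => ?_⟩
  obtain ⟨x, l, hl, hμ, hg⟩ := exists_cover_superlevel hp0 (fun y => norm_nonneg _) hIW
  rw [hp, one_div_div] at hg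
  have hfc : ContinuousOn (fun z => ‖fderiv ℝ u z‖) Ω :=
    (hu.continuousOn_fderiv_of_isOpen hΩ.isOpen le_rfl).norm
  have hweak : ∀ s, 0 < s → hausdorffContent δ {x | x ∈ Ω ∧ s < |u x - b|} ≤
      ENNReal.ofReal (C * (W ^ (1 / p) / s) ^ σ) := by
    intro s hs
    have hs1 : 0 < c₁ * s := by positivity
    refine (hausdorffContent_le_of_density (v := (c₁ * s) ^ p) (C := 1 / τ + 3) hD0 hDδ
      (by positivity) (by positivity) hW _ hμ ?_).trans (le_of_eq ?_)
    · rintro z ⟨hz, hsz⟩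
      obtain ⟨y, ρ, hρ, hzy, hball, hlt⟩ := hb z hz s hs hsz
      refine exists_density_of_lt_lintegral x l hl (by omega) hδ hδn hε hη1 hτ hs1 y z hρ hzy
        (fun w hw => hg w (hball hw)) ?_
      have hint : IntegrableOn (fun z => ‖fderiv ℝ u z‖) (Metric.closedBall y ρ) :=
        (hfc.mono hball).integrableOn_compact (isCompact_closedBall _ _)
      rw [← ofReal_integral_eq_lintegral_ofReal hint
        (Filter.Eventually.of_forall fun _ => norm_nonneg _)]
      have hcs : 4 * (c₁ * s) * ω = c * s := by rw [hc₁]; field_simp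
      rw [ENNReal.ofReal_lt_ofReal_iff_of_nonneg (by positivity), ← hω, hcs]
      exact hlt
    · congr 1
      rw [hC, mul_assoc, ← Real.mul_rpow (by positivity) (by positivity)]
      congr 1
      have h1 : W = (W ^ (1 / p)) ^ p := by
        rw [← Real.rpow_mul hW.le, one_div_mul_cancel hp0.ne', Real.rpow_one]
      conv_lhs => rw [h1]
      rw [← Real.div_rpow (by positivity) hs1.le, ← Real.rpow_mul (by positivity), hσ, mul_div_assoc]
      congr 1
      field_simp
  have := choquetIntegral_rpow_le_of_weakType hq0 hqσ (by positivity) hC0.le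
    (Real.rpow_pos_of_pos hW (1 / p)) (hausdorffContent_le_of_isBoundedJohnDomain hδ hβ hΩ)
    (fun x => u x - b) hweak
  rw [ENNReal.ofReal_rpow_of_pos hW]
  rw [one_div_div] at this ⊢
  rwa [hp, one_div_div] at this

end JohnDomain

theorem theorem1p1 (n : ℕ) (hn : 2 ≤ n) (α β δ ε : ℝ)
    (hδ : 0 < δ) (hδn : δ ≤ n) (hε : 0 < ε) (hεδ : ε < δ * (1 - 1 / (n : ℝ))) (h : ℝ≥0∞) :
    ∃ c : ℝ, 0 < c ∧
      ∀ Ω : Set (EuclideanSpace ℝ (Fin n)), IsBoundedJohnDomain α β Ω →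
        hausdorffContent δ Ω = h →
        ∀ u : EuclideanSpace ℝ (Fin n) → ℝ, ContDiffOn ℝ 1 u Ω →
          (⨅ b : ℝ, (choquetIntegral δ Ω
              fun x => ENNReal.ofReal (|u x - b| ^ (δ / ((n : ℝ) - 1)))) ^ (((n : ℝ) - 1) / δ))
            ≤ ENNReal.ofReal c * (choquetIntegral (δ - ε) Ω
              fun x => ENNReal.ofReal (‖∇ u x‖ ^ (δ / (n : ℝ)))) ^ ((n : ℝ) / δ) := by
  by_cases hαβ : 0 < α ∧ 0 < β
  swap
  · exact ⟨1, one_pos, fun Ω hΩ => absurd ⟨hΩ.pos, hΩ.pos.trans_le hΩ.le⟩ hαβ⟩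
  obtain ⟨K, hK0, hK⟩ := exists_poincareSobolev_const hn hαβ.1 hαβ.2 hδ hδn hε hεδ
  have hnδ : 0 < (n : ℝ) / δ := div_pos (by exact_mod_cast (by omega : 0 < n)) hδ
  refine ⟨K * 4 ^ ((n : ℝ) / δ), by positivity, fun Ω hΩ _ u hu => ?_⟩
  obtain ⟨b, hb⟩ := hK Ω hΩ u hu
  refine (iInf_le _ b).trans ?_
  have hgrad : ∀ x, ‖∇ u x‖ = ‖fderiv ℝ u x‖ := fun x => by simp [gradient]
  simp only [hgrad]
  set I := choquetIntegral (δ - ε) Ω fun x => ENNReal.ofReal (‖fderiv ℝ u x‖ ^ (δ / (n : ℝ)))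
  rcases eq_or_ne I ∞ with hI | hI
  · rw [hI, ENNReal.top_rpow_of_pos hnδ, ENNReal.mul_top (by
      rw [Ne, ENNReal.ofReal_eq_zero, not_le]; positivity)]
    exact le_top
  have h4I : 4 * I = ENNReal.ofReal (4 * I.toReal) := by
    rw [ENNReal.ofReal_mul (by norm_num), ENNReal.ofReal_toReal hI, ENNReal.ofReal_ofNat]
  -- `W` must be positive and strictly above `4 * I`, so `W = 4 * I + e` with `e` decreasing to `0`;
  -- this also covers `I = 0`.
  have hlim : Filter.Tendsto
      (fun e : ℝ => ENNReal.ofReal K * ENNReal.ofReal (4 * I.toReal + e) ^ ((n : ℝ) / δ))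
      (nhdsWithin 0 (Set.Ioi 0))
      (nhds (ENNReal.ofReal K * ENNReal.ofReal (4 * I.toReal + 0) ^ ((n : ℝ) / δ))) := by
    refine ENNReal.Tendsto.const_mul ?_ (Or.inr ENNReal.ofReal_ne_top)
    refine (ENNReal.continuous_rpow_const.tendsto _).comp (ENNReal.tendsto_ofReal ?_)
    exact ((continuous_const.add continuous_id).tendsto (0 : ℝ)).mono_left inf_le_left
  refine (ge_of_tendsto hlim ?_).trans (le_of_eq ?_)
  · filter_upwards [self_mem_nhdsWithin] with e he
    have he0 : (0 : ℝ) < e := he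
    have hI0 : 0 ≤ 4 * I.toReal := by positivity
    refine hb _ (by linarith) ?_
    rw [h4I]
    exact (ENNReal.ofReal_lt_ofReal_iff (by linarith)).2 (by linarith)
  · rw [add_zero, ← h4I, ENNReal.mul_rpow_of_nonneg _ _ hnδ.le, ENNReal.ofReal_mul hK0.le,
      ← ENNReal.ofReal_rpow_of_pos (by norm_num), ENNReal.ofReal_ofNat, mul_assoc]
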